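/- Let $\mathcal A$ be a finite set with the discrete topology, and let $\sigma$ be the left shift on $\mathcal A^{\mathbb Z}$, $(\sigma x)(n)=x(n+1)$. Let $X\subseteq\mathcal A^{\mathbb Z}$ be a shift, that is, a set closed in the product topology with $\sigma(X)=X$. Suppose that $X$ is transitive, meaning that there is $x\in X$ whose orbit $\{\sigma^n x : n\in\mathbb Z\}$ has closure $X$. For $n\ge 0$ let $P_X(n)$ be the number of words $w\in\mathcal A^n$ for which there is $x\in X$ with $x(i)=w_i$ for $0\le i<n$, and suppose that $$0<\limsup_{n\to\infty}\frac{P_X(n)}{n}<\infty .$$ Let $\mathrm{Aut}(X)$ be the group of homeomorphisms $X\to X$ that commute with $\sigma$, and let $\langle\sigma\rangle$ be its (central) subgroup generated by $\sigma$. Then $\mathrm{Aut}(X)/\langle\sigma\rangle$ is finite. In particular, $\mathrm{Aut}(X)$ is virtually $\mathbb Z$, that is, it has a subgroup of finite index isomorphic to $\mathbb Z$. -/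

import Mathlib

namespace LowComplexity

open SymbolicDynamics.FullShift

variable {A : Type*} [TopologicalSpace A]

/-- The shift by `n : ℤ` as a homeomorphism of `X`. Here `X : Subshift A ℤ` is a closed subset
of `ℤ → A` that is invariant under `σⁿ` for all `n : ℤ`, that is, `σ X = X`. -/
def shiftHomeo (X : Subshift A ℤ) (n : ℤ) : X.carrier ≃ₜ X.carrier where
  toFun x := ⟨shift n x.1, X.mapsTo n x.2⟩
  invFun x := ⟨shift (-n) x.1, X.mapsTo (-n) x.2⟩
  left_inv x := by
    apply Subtype.ext
    funext h
    simp [shift]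
  right_inv x := by
    apply Subtype.ext
    funext h
    simp [shift]
  continuous_toFun := ((continuous_shift n).comp continuous_subtype_val).subtype_mk _
  continuous_invFun := ((continuous_shift (-n)).comp continuous_subtype_val).subtype_mk _

/-- The left shift `σ` as a homeomorphism of `X`, `(σ x)(m) = x(m + 1)`. -/
def sigma (X : Subshift A ℤ) : X.carrier ≃ₜ X.carrier := shiftHomeo X 1

/-- The (two-sided) orbit `{σⁿ x : n ∈ ℤ}` of a configuration. -/
def orbit (x : ℤ → A) : Set (ℤ → A) := Set.range fun n : ℤ => shift n x

/-- `X` is transitive: some point of `X` has orbit closure equal to `X`. -/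
def IsTransitive (X : Subshift A ℤ) : Prop :=
  ∃ x ∈ X.carrier, closure (orbit x) = X.carrier

/-- The set `L_n(X)` of words of length `n` that occur in `X`. -/
def words (X : Subshift A ℤ) (n : ℕ) : Set (Fin n → A) :=
  {w | ∃ x ∈ X.carrier, ∀ i : Fin n, x ((i : ℕ) : ℤ) = w i}

/-- The complexity function `P_X(n) = |L_n(X)|` (the alphabet is finite wherever this is used). -/
noncomputable def complexity (X : Subshift A ℤ) (n : ℕ) : ℕ := (words X n).ncard

/-- `limsup P_X(n) / n` as `n → ∞`, with values in `[0, ∞]`. -/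
noncomputable def growthRate (X : Subshift A ℤ) : ENNReal :=
  Filter.limsup (fun n : ℕ => (complexity X n : ENNReal) / (n : ENNReal)) Filter.atTop

/-- `Aut(X)`: the centralizer of `σ` in the group of homeomorphisms of `X`. -/
def Aut (X : Subshift A ℤ) : Subgroup (X.carrier ≃ₜ X.carrier) :=
  Subgroup.centralizer {sigma X}

/-- The shift as an element of `Aut(X)`. -/
def sigmaAut (X : Subshift A ℤ) : Aut X :=
  ⟨sigma X, Subgroup.mem_centralizer_iff.2 fun h hh => by rw [Set.mem_singleton_iff.1 hh]⟩

/-- The subgroup `⟨σ⟩` of `Aut(X)`. -/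
def shiftSubgroup (X : Subshift A ℤ) : Subgroup (Aut X) := Subgroup.zpowers (sigmaAut X)

/-- `⟨σ⟩` is normal (indeed central), so that `Aut(X) ⧸ ⟨σ⟩` is a group. -/
instance shiftSubgroup_normal (X : Subshift A ℤ) : (shiftSubgroup X).Normal where
  conj_mem := by
    rintro _ ⟨n, rfl⟩ g
    have hg : Commute g (sigmaAut X) := by
      apply Subtype.ext
      exact (Subgroup.mem_centralizer_iff.1 g.2 (sigma X) rfl).symm
    refine ⟨n, ?_⟩
    show sigmaAut X ^ n = g * sigmaAut X ^ n * g⁻¹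
    rw [(hg.zpow_right n).eq, mul_inv_cancel_right]

/-- `G` is virtually `H`: `G` has a subgroup of finite index that is isomorphic to `H`. -/
def IsVirtually (G H : Type*) [Group G] [Group H] : Prop :=
  ∃ K : Subgroup G, K.FiniteIndex ∧ Nonempty (K ≃* H)

end LowComplexity

/-! If `X` has an isolated point, the isolated points all lie on the orbit of the transitive point.
An automorphism permutes them, and it is determined by its value at a transitive point, so it is a
power of `σ`.

Otherwise words recur and never determine the future or the past. Take finitely many automorphisms,
distinct modulo `σ`; they and their inverses are block codes of a common radius `R`. A long window
of the transitive point tells their images apart even after small shifts (`exists_separates`). If a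
word contains this window and has two left extensions, each automorphism maps it to a left special
word, and these are distinct (`card_le_ncard_leftSpecial`). Hence `P_X(m + 1) - P_X(m)` is at least
the number of automorphisms for all `m` in a range as long as the word to the right of the window.
Right extensions give the mirror bound. A bispecial word of length `N` (`exists_bispecial`) makes
both bounds available; their sum is about `N` times the number of automorphisms and at most `2
P_X(N) ≤ 2 C N`. -/

namespace LowComplexity

/-! ### Left special words and complexity increments. -/

section Combinatorics

variable {A : Type*}

/-- `S` is invariant under all powers of the shift. -/
def ShiftInvariant (S : Set (ℤ → A)) : Prop :=
  ∀ x ∈ S, ∀ n : ℤ, (fun k => x (n + k)) ∈ S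

/-- The words of length `m` that occur in `S`. -/
def blocks (S : Set (ℤ → A)) (m : ℕ) : Set (Fin m → A) :=
  {w | ∃ x ∈ S, ∀ i : Fin m, x ((i : ℕ) : ℤ) = w i}

/-- The words of length `m` that have at least two extensions to the left in `S`. -/
def leftSpecial (S : Set (ℤ → A)) (m : ℕ) : Set (Fin m → A) :=
  {w | ∃ x ∈ S, ∃ y ∈ S, x (-1) ≠ y (-1) ∧
    ∀ i : Fin m, x ((i : ℕ) : ℤ) = w i ∧ y ((i : ℕ) : ℤ) = w i}

/-- Deleting the first letter maps words of length `m + 1` onto words of length `m`. A left special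
word has two preimages, so one of them lies outside the section `E`. -/
lemma ncard_leftSpecial_add_ncard_blocks_le [Finite A] {S : Set (ℤ → A)}
    (hS : ShiftInvariant S) (m : ℕ) :
    (leftSpecial S m).ncard + (blocks S m).ncard ≤ (blocks S (m + 1)).ncard := by
  have hext : ∀ x ∈ S, (fun i : Fin (m + 1) => x (-1 + ((i : ℕ) : ℤ))) ∈ blocks S (m + 1) :=
    fun x hx => ⟨_, hS x hx (-1), fun i => rfl⟩
  have htail : ∀ (x : ℤ → A) (w : Fin m → A), (∀ i : Fin m, x ((i : ℕ) : ℤ) = w i) →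
      Fin.tail (fun i : Fin (m + 1) => x (-1 + ((i : ℕ) : ℤ))) = w := by
    intro x w h
    funext i
    simp [Fin.tail, ← h i]
  have hsurj : Set.SurjOn (Fin.tail : (Fin (m + 1) → A) → Fin m → A)
      (blocks S (m + 1)) (blocks S m) := by
    rintro w ⟨x, hx, hxw⟩
    exact ⟨_, hext x hx, htail x w hxw⟩
  obtain ⟨E, hE, hbij⟩ := hsurj.exists_bijOn_subset
  have hEcard : E.ncard = (blocks S m).ncard := by
    rw [← hbij.image_eq, hbij.injOn.ncard_image]
  have hsub : leftSpecial S m ⊆ Fin.tail '' (blocks S (m + 1) \ E) := by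
    rintro w ⟨x, hx, y, hy, hxy, hw⟩
    have h1 := htail x w fun i => (hw i).1
    have h2 := htail y w fun i => (hw i).2
    by_cases hxE : (fun i : Fin (m + 1) => x (-1 + ((i : ℕ) : ℤ))) ∈ E
    · refine ⟨_, ⟨hext y hy, fun hyE => hxy ?_⟩, h2⟩
      have := congrFun (hbij.injOn hxE hyE (h1.trans h2.symm)) 0
      simpa using this
    · exact ⟨_, ⟨hext x hx, hxE⟩, h1⟩
  have h3 := (Set.ncard_le_ncard hsub (Set.toFinite _)).trans
    (Set.ncard_image_le (Set.toFinite _))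
  have h4 := Set.ncard_sdiff_add_ncard_of_subset hE (Set.toFinite _)
  omega

/-! ### Images of left special words under block codes. -/

/-- `f` is a family of sliding block codes `S → S` of radius at most `R`, with left inverses `g`
of radius at most `R`. -/
structure LocalFamily {ι : Type*} (S : Set (ℤ → A)) (R : ℕ)
    (f g : ι → (ℤ → A) → (ℤ → A)) : Prop where
  mapsTo : ∀ i, ∀ x ∈ S, f i x ∈ S
  leftInv : ∀ i, ∀ x ∈ S, g i (f i x) = x
  shift : ∀ i, ∀ x ∈ S, ∀ n k : ℤ, f i (fun l => x (n + l)) k = f i x (n + k)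
  loc : ∀ i, ∀ x ∈ S, ∀ y ∈ S, ∀ k : ℤ,
    (∀ l, k - R ≤ l → l ≤ k + R → x l = y l) → f i x k = f i y k
  locInv : ∀ i, ∀ x ∈ S, ∀ y ∈ S, ∀ k : ℤ,
    (∀ l, k - R ≤ l → l ≤ k + R → x l = y l) → g i x k = g i y k

/-- The window `[-M, M]` of the images of `x₀` tells the members of `f` apart, even up to a shift
by at most `2R`. -/
def Separates {ι : Type*} (x₀ : ℤ → A) (R M : ℕ) (f : ι → (ℤ → A) → (ℤ → A)) : Prop :=
  ∀ i j, i ≠ j → ∀ c : ℤ, -(2 * R) ≤ c → c ≤ 2 * R →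
    ∃ p : ℤ, -M ≤ p ∧ p ≤ M ∧ f i x₀ p ≠ f j x₀ (p + c)

variable {ι : Type*} {S : Set (ℤ → A)} {R M : ℕ} {f g : ι → (ℤ → A) → (ℤ → A)}

/-- If the last disagreement of two points before a common block is at `p`, then the last
disagreement of their images before the image of that block is close to `p`. -/
lemma LocalFamily.exists_disagreement (h : LocalFamily S R f g) (i : ι) {x y : ℤ → A}
    (hx : x ∈ S) (hy : y ∈ S) {p : ℤ} {n : ℕ} (hp : x p ≠ y p)
    (hxy : ∀ l, p < l → l ≤ p + n → x l = y l) :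
    ∃ j : ℤ, p - R ≤ j ∧ j ≤ p + R ∧ f i x j ≠ f i y j ∧
      ∀ l, j < l → l ≤ p + n - R → f i x l = f i y l := by
  obtain ⟨j₀, hj₀, hj₀', hne⟩ : ∃ j : ℤ, p - R ≤ j ∧ j ≤ p + R ∧ f i x j ≠ f i y j := by
    -- If the images agreed on `[p - R, p + R]`, the inverse code would give `x p = y p`.
    by_contra! hcon
    apply hp
    rw [← h.leftInv i x hx, ← h.leftInv i y hy]
    exact h.locInv i _ (h.mapsTo i x hx) _ (h.mapsTo i y hy) p hcon
  obtain ⟨j, ⟨hj, hj'⟩, hmax⟩ := Int.exists_greatest_of_bdd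
    (P := fun j => j ≤ p + R ∧ f i x j ≠ f i y j) ⟨p + R, fun z hz => hz.1⟩ ⟨j₀, hj₀', hne⟩
  refine ⟨j, hj₀.trans (hmax _ ⟨hj₀', hne⟩), hj, hj', fun l hl hl' => ?_⟩
  by_cases hlR : l ≤ p + R
  · by_contra hcon
    have := hmax l ⟨hlR, hcon⟩
    omega
  · refine h.loc i x hx y hy l fun t ht ht' => hxy t ?_ ?_ <;> omega

/-- The word of `f i x` that starts just after the last disagreement `j i` is left special and
contains the image of the window. The `j i` differ by at most `2R`, so two equal words would
contradict `Separates`. -/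
lemma LocalFamily.card_le_ncard_leftSpecial [Finite A] [Finite ι] (hS : ShiftInvariant S)
    (h : LocalFamily S R f g) {x₀ : ℤ → A} (hx₀ : x₀ ∈ S) (hsep : Separates x₀ R M f)
    {x y : ℤ → A} (hx : x ∈ S) (hy : y ∈ S) {p k : ℤ} {m : ℕ} (hp : x p ≠ y p)
    (hxy : ∀ l, p < l → l ≤ p + (m + 2 * R : ℕ) → x l = y l)
    (hk : ∀ l : ℤ, -(M + 3 * R : ℕ) ≤ l → l ≤ (M + 3 * R : ℕ) → x (k + l) = x₀ l)
    (hpk : p < k - (M + 3 * R : ℕ)) (hkp : k + (M + 3 * R : ℕ) ≤ p + (m + 2 * R : ℕ)) :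
    Nat.card ι ≤ (leftSpecial S m).ncard := by
  choose j hj hj' hne heq using fun i => h.exists_disagreement i hx hy hp hxy
  have hloc : ∀ i (q : ℤ), -(M + 2 * R : ℕ) ≤ q → q ≤ (M + 2 * R : ℕ) →
      f i x (k + q) = f i x₀ q := by
    intro i q hq hq'
    rw [← h.shift i x hx k q]
    refine h.loc i _ (hS x hx k) _ hx₀ q fun l hl hl' => hk l ?_ ?_ <;> push_cast at * <;> omega
  let F : ι → leftSpecial S m := fun i => ⟨fun t => f i x (j i + 1 + ((t : ℕ) : ℤ)),
    _, hS _ (h.mapsTo i x hx) (j i + 1), _, hS _ (h.mapsTo i y hy) (j i + 1), by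
      simpa using hne i, fun t => ⟨rfl, (heq i _ (by omega) (by
        have := t.2; have := hj' i; push_cast; omega)).symm⟩⟩
  have hF : Function.Injective F := by
    intro i i' hii
    by_contra hcon
    have h1 := hj i
    have h2 := hj' i
    have h3 := hj i'
    have h4 := hj' i'
    obtain ⟨q, hq, hq', hqne⟩ := hsep i i' hcon (j i' - j i) (by omega) (by omega)
    push_cast at hpk hkp
    obtain ⟨t, ht⟩ : ∃ t : ℕ, (t : ℤ) = k + q - (j i + 1) := ⟨(k + q - (j i + 1)).toNat, by omega⟩
    have htm : t < m := by omega
    have h5 := congrFun (congrArg Subtype.val hii) ⟨t, htm⟩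
    simp only [F, ht] at h5
    apply hqne
    rw [← hloc i q (by push_cast; omega) (by push_cast; omega),
      ← hloc i' _ (by push_cast; omega) (by push_cast; omega)]
    convert h5 using 2 <;> ring
  exact Nat.card_le_card_of_injective F hF

lemma ncard_blocks_mono [Finite A] (hS : ShiftInvariant S) :
    Monotone fun m => (blocks S m).ncard :=
  monotone_nat_of_le_succ fun m => by
    have := ncard_leftSpecial_add_ncard_blocks_le hS m
    omega

/-- A long word that contains the window of `x₀` and has two extensions to the left forces the
complexity to be large, in terms of the length of the word to the right of the window. -/
lemma LocalFamily.mul_card_le_of_left [Finite A] [Finite ι] (hS : ShiftInvariant S)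
    (h : LocalFamily S R f g) {x₀ : ℤ → A} (hx₀ : x₀ ∈ S) (hsep : Separates x₀ R M f)
    {x y : ℤ → A} (hx : x ∈ S) (hy : y ∈ S) {p q k : ℤ} (hp : x p ≠ y p)
    (hxy : ∀ l, p < l → l < q → x l = y l)
    (hk : ∀ l : ℤ, -(M + 3 * R : ℕ) ≤ l → l ≤ (M + 3 * R : ℕ) → x (k + l) = x₀ l)
    (hpk : p < k - (M + 3 * R : ℕ)) (hkq : k + (M + 3 * R : ℕ) < q) {N : ℕ} (hN : N = q - p - 1) :
    (q - 1 - (k + (M + 3 * R : ℕ))) * Nat.card ι ≤ (blocks S N).ncard := by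
  -- `a` is the least `m` for which `(p, p + m + 2R]` covers the window.
  obtain ⟨a, ha⟩ : ∃ a : ℕ, (a : ℤ) = k + (M + 3 * R : ℕ) - p - 2 * R :=
    ⟨(k + (M + 3 * R : ℕ) - p - 2 * R).toNat, by push_cast at *; omega⟩
  have key : ∀ d : ℕ, (a + d + 2 * R : ℕ) ≤ N → d * Nat.card ι ≤ (blocks S (a + d)).ncard := by
    intro d
    induction d with
    | zero => simp
    | succ d ih =>
      intro hd
      have h1 := ih (by omega)
      have h2 := h.card_le_ncard_leftSpecial hS hx₀ hsep hx hy (k := k) (m := a + d) hp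
        (fun l hl hl' => hxy l hl (by push_cast at *; omega)) hk hpk (by push_cast at *; omega)
      have h3 := ncard_leftSpecial_add_ncard_blocks_le hS (a + d)
      rw [← add_assoc]
      linarith [add_mul d 1 (Nat.card ι)]
  obtain ⟨d, hd⟩ : ∃ d : ℕ, (d : ℤ) = q - 1 - (k + (M + 3 * R : ℕ)) :=
    ⟨(q - 1 - (k + (M + 3 * R : ℕ))).toNat, by push_cast at *; omega⟩
  rw [← hd]
  have h1 := key d (by push_cast at *; omega)
  have h2 : (blocks S (a + d)).ncard ≤ (blocks S N).ncard :=
    ncard_blocks_mono hS (by push_cast at *; omega)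
  exact_mod_cast h1.trans h2

/-! ### Reflection, for right special words. -/

/-- The mirror image of a set of configurations. -/
def mirror (S : Set (ℤ → A)) : Set (ℤ → A) := {x | (fun k => x (-k)) ∈ S}

lemma mem_mirror {x : ℤ → A} : x ∈ mirror S ↔ (fun k => x (-k)) ∈ S := Iff.rfl

lemma neg_mem_mirror {x : ℤ → A} (hx : x ∈ S) : (fun k => x (-k)) ∈ mirror S := by
  simpa [mem_mirror] using hx

lemma ShiftInvariant.mirror (hS : ShiftInvariant S) : ShiftInvariant (mirror S) := by
  intro x hx n
  have := hS _ hx (-n)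
  simp only [mem_mirror]
  convert this using 2
  ring_nf

lemma ncard_blocks_mirror_le [Finite A] (hS : ShiftInvariant S) (m : ℕ) :
    (blocks (mirror S) m).ncard ≤ (blocks S m).ncard := by
  have : blocks (mirror S) m ⊆ (fun w : Fin m → A => w ∘ Fin.rev) '' blocks S m := by
    rintro w ⟨x, hx, hxw⟩
    refine ⟨w ∘ Fin.rev, ⟨_, hS _ hx (-((m : ℤ) - 1)), fun i => ?_⟩, ?_⟩
    · rw [Function.comp, ← hxw]
      congr 1
      have := i.2
      rw [Fin.val_rev]
      omega
    · funext i
      simp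
  exact (Set.ncard_le_ncard this (Set.toFinite _)).trans (Set.ncard_image_le (Set.toFinite _))

lemma LocalFamily.mirror (h : LocalFamily S R f g) :
    LocalFamily (mirror S) R (fun i x k => f i (fun l => x (-l)) (-k))
      (fun i x k => g i (fun l => x (-l)) (-k)) where
  mapsTo i x hx := neg_mem_mirror (h.mapsTo i _ hx)
  leftInv i x hx := by
    funext k
    simp [h.leftInv i _ hx]
  shift i x hx n k := by
    have := h.shift i _ hx (-n) (-k)
    rw [neg_add, ← this]
    congr 1
    funext l
    ring_nf
  loc i x hx y hy k hxy :=
    h.loc i _ hx _ hy (-k) fun l hl hl' => hxy _ (by omega) (by omega)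
  locInv i x hx y hy k hxy :=
    h.locInv i _ hx _ hy (-k) fun l hl hl' => hxy _ (by omega) (by omega)

lemma Separates.mirror {x₀ : ℤ → A} (hsep : Separates x₀ R M f) :
    Separates (fun k => x₀ (-k)) R M (fun i x k => f i (fun l => x (-l)) (-k)) := by
  intro i j hij c hc hc'
  obtain ⟨p, hp, hp', hne⟩ := hsep i j hij (-c) (by omega) (by omega)
  refine ⟨-p, by omega, by omega, ?_⟩
  simpa [add_comm] using hne

lemma LocalFamily.mul_card_le_of_right [Finite A] [Finite ι] (hS : ShiftInvariant S)
    (h : LocalFamily S R f g) {x₀ : ℤ → A} (hx₀ : x₀ ∈ S) (hsep : Separates x₀ R M f)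
    {x y : ℤ → A} (hx : x ∈ S) (hy : y ∈ S) {p q k : ℤ} (hq : x q ≠ y q)
    (hxy : ∀ l, p < l → l < q → x l = y l)
    (hk : ∀ l : ℤ, -(M + 3 * R : ℕ) ≤ l → l ≤ (M + 3 * R : ℕ) → x (k + l) = x₀ l)
    (hpk : p < k - (M + 3 * R : ℕ)) (hkq : k + (M + 3 * R : ℕ) < q) {N : ℕ} (hN : N = q - p - 1) :
    (k - (M + 3 * R : ℕ) - 1 - p) * Nat.card ι ≤ (blocks S N).ncard := by
  have := h.mirror.mul_card_le_of_left hS.mirror (neg_mem_mirror hx₀) hsep.mirror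
    (neg_mem_mirror hx) (neg_mem_mirror hy) (p := -q) (q := -p) (k := -k) (N := N)
    (by simpa using hq) (fun l hl hl' => hxy _ (by omega) (by omega))
    (fun l hl hl' => by rw [← hk (-l) (by omega) (by omega)]; ring_nf)
    (by omega) (by omega) (by omega)
  have h2 : ((blocks (LowComplexity.mirror S) N).ncard : ℤ) ≤ (blocks S N).ncard := by
    exact_mod_cast ncard_blocks_mirror_le hS N
  refine le_trans (le_of_eq ?_) (this.trans h2)
  ring

/-! ### Recurrence and bispecial words. -/

/-- Every word of `S` and every prescribed distance recur at some larger distance. -/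
def Recurrent (S : Set (ℤ → A)) : Prop :=
  ∀ z ∈ S, ∀ n K : ℕ, ∃ y ∈ S, ∃ k : ℤ, K ≤ k ∧
    ∀ l : ℤ, -n ≤ l → l ≤ n → y l = z l ∧ y (k + l) = z l

/-- No point of `S` is isolated. -/
def NoIsolated (S : Set (ℤ → A)) : Prop :=
  ∀ z ∈ S, ∀ n : ℕ, ∃ y ∈ S, y ≠ z ∧ ∀ l : ℤ, -n ≤ l → l ≤ n → y l = z l

lemma Recurrent.mirror (hS : ShiftInvariant S) (h : Recurrent S) : Recurrent (mirror S) := by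
  intro z hz n K
  obtain ⟨y, hy, k, hk, hyz⟩ := h _ hz n K
  refine ⟨fun l => y (k + -l), neg_mem_mirror (hS y hy k), k, hk, fun l hl hl' => ?_⟩
  have := hyz (-l) (by omega) (by omega)
  simpa using this.symm

lemma NoIsolated.mirror (h : NoIsolated S) : NoIsolated (mirror S) := by
  intro z hz n
  obtain ⟨y, hy, hne, hyz⟩ := h _ hz n
  refine ⟨_, neg_mem_mirror hy, fun hcon => hne ?_, fun l hl hl' => ?_⟩
  · rw [← hcon]
    simp
  · have := hyz (-l) (by omega) (by omega)
    simpa using this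

/-- No word of `S` determines the future. -/
lemma exists_disagreement_right (hS : ShiftInvariant S) (hrec : Recurrent S) (hiso : NoIsolated S)
    {x : ℤ → A} (hx : x ∈ S) (n : ℕ) :
    ∃ y ∈ S, ∃ z ∈ S, (∀ l : ℤ, -n ≤ l → l ≤ n → y l = x l) ∧
      (∀ l : ℤ, -n ≤ l → l ≤ n → z l = x l) ∧ ∃ j : ℤ, n < j ∧ y j ≠ z j := by
  by_contra! hcon
  have huniq : ∀ y ∈ S, (∀ l : ℤ, -n ≤ l → l ≤ n → y l = x l) → ∀ j : ℤ, -n ≤ j → y j = x j := by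
    intro y hy hyx j hj
    by_cases hjn : j ≤ n
    · exact hyx j hj hjn
    · exact hcon y hy x hx hyx (fun _ _ _ => rfl) j (by omega)
  -- If the block on `[-n, n]` determines the future, its return after time `t` makes `x` periodic
  -- to the right.
  obtain ⟨y, hy, t, ht, hyt⟩ := hrec x hx n 1
  have hper : ∀ j : ℤ, -n ≤ j → x (t + j) = x j := by
    intro j hj
    have h1 := huniq y hy (fun l hl hl' => (hyt l hl hl').1) (t + j) (by omega)
    have h2 := huniq _ (hS y hy t) (fun l hl hl' => (hyt l hl hl').2) j hj
    rw [← h1, h2]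
  -- Any block of such a `z` recurs far to the right in a point whose future is that of `x`, so `z`
  -- is periodic on both sides.
  have hper' : ∀ z ∈ S, (∀ l : ℤ, -n ≤ l → l ≤ n → z l = x l) → ∀ j : ℤ, z (t + j) = z j := by
    intro z hz hzx j
    obtain ⟨m, hm⟩ : ∃ m : ℕ, m = n + j.natAbs + t.natAbs := ⟨_, rfl⟩
    obtain ⟨y, hy, k, hk, hyk⟩ := hrec z hz m m
    have hyx := huniq y hy fun l hl hl' =>
      ((hyk l (by omega) (by omega)).1.trans (hzx l hl hl'))
    rw [← (hyk j (by omega) (by omega)).2, ← (hyk (t + j) (by omega) (by omega)).2,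
      hyx _ (by omega), hyx _ (by omega), ← hper (k + j) (by omega)]
    ring_nf
  obtain ⟨z, hz, hne, hzx⟩ := hiso x hx n
  refine hne (funext fun j => ?_)
  have hmul : ∀ w : ℤ → A, (∀ j, w (t + j) = w j) → ∀ (a : ℕ) (j : ℤ), w (a * t + j) = w j := by
    intro w hw a
    induction a with
    | zero => simp
    | succ a ih =>
      intro j
      rw [← ih j, ← hw (a * t + j)]
      push_cast
      ring_nf
  rw [← hmul z (hper' z hz hzx) (n + j.natAbs) j,
    ← hmul x (hper' x hx fun _ _ _ => rfl) (n + j.natAbs) j]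
  refine huniq z hz hzx _ ?_
  have h1 : ((n + j.natAbs : ℕ) : ℤ) * 1 ≤ (n + j.natAbs : ℕ) * t :=
    mul_le_mul_of_nonneg_left (by omega) (Int.natCast_nonneg _)
  omega

/-- Arbitrarily long words that contain a given word and have two extensions on either side. -/
lemma exists_bispecial (hS : ShiftInvariant S) (hrec : Recurrent S) (hiso : NoIsolated S)
    {x : ℤ → A} (hx : x ∈ S) (n : ℕ) :
    ∃ u ∈ S, ∃ v ∈ S, ∃ u' ∈ S, ∃ v' ∈ S, ∃ p q : ℤ, p < -n ∧ n < q ∧ u p ≠ v p ∧ u' q ≠ v' q ∧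
      (∀ l : ℤ, p < l → l < q → u l = v l) ∧ (∀ l : ℤ, p < l → l < q → u' l = v' l) ∧
      (∀ l : ℤ, -n ≤ l → l ≤ n → u l = x l) ∧ (∀ l : ℤ, -n ≤ l → l ≤ n → u' l = x l) := by
  obtain ⟨y, hy, z, hz, hyx, hzx, j, hj, hne⟩ :=
    exists_disagreement_right hS.mirror (hrec.mirror hS) hiso.mirror (neg_mem_mirror hx) n
  obtain ⟨p, ⟨hp, hpne⟩, hpmax⟩ := Int.exists_greatest_of_bdd
    (P := fun p => p < -n ∧ y (-p) ≠ z (-p)) ⟨-n, fun _ h => h.1.le⟩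
    ⟨-j, by omega, by simpa using hne⟩
  set u : ℤ → A := fun k => y (-k) with hu
  set v : ℤ → A := fun k => z (-k) with hv
  have hux : ∀ l : ℤ, -n ≤ l → l ≤ n → u l = x l := fun l hl hl' => by
    simpa using hyx (-l) (by omega) (by omega)
  have hvx : ∀ l : ℤ, -n ≤ l → l ≤ n → v l = x l := fun l hl hl' => by
    simpa using hzx (-l) (by omega) (by omega)
  have huv : ∀ l : ℤ, p < l → l ≤ n → u l = v l := by
    intro l hl hl'
    by_cases hln : -n ≤ l
    · rw [hux l hln hl', hvx l hln hl']
    · by_contra hcon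
      have := hpmax l ⟨by omega, hcon⟩
      omega
  -- The least `q` at which any two extensions of the word on `(p, n]` differ. By minimality `u`,
  -- `v` also agree up to `q`, so one word on `(p, q)` is special on both sides.
  let P : ℤ → Prop := fun q => n < q ∧ ∃ a ∈ S, ∃ b ∈ S,
    (∀ l : ℤ, p < l → l ≤ n → a l = u l) ∧ (∀ l : ℤ, p < l → l ≤ n → b l = u l) ∧ a q ≠ b q
  obtain ⟨a, ha, b, hb, hau, hbu, i, hi, hab⟩ :=
    exists_disagreement_right hS hrec hiso (show u ∈ S from hy) p.natAbs
  obtain ⟨q, ⟨hq, a, ha, b, hb, hau, hbu, hab⟩, hqmin⟩ :=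
    Int.exists_least_of_bdd (P := P) ⟨n, fun _ h => h.1.le⟩
      ⟨i, by omega, a, ha, b, hb, fun l hl hl' => hau l (by omega) (by omega),
        fun l hl hl' => hbu l (by omega) (by omega), hab⟩
  have hext : ∀ a ∈ S, ∀ b ∈ S, (∀ l : ℤ, p < l → l ≤ n → a l = u l) →
      (∀ l : ℤ, p < l → l ≤ n → b l = u l) → ∀ l : ℤ, p < l → l < q → a l = b l := by
    intro a ha b hb hau hbu l hl hl'
    by_cases hln : l ≤ n
    · rw [hau l hl hln, hbu l hl hln]
    · by_contra hcon
      have := hqmin l ⟨by omega, a, ha, b, hb, hau, hbu, hcon⟩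
      omega
  refine ⟨u, hy, v, hz, a, ha, b, hb, p, q, hp, hq, hpne, hab,
    hext u hy v hz (fun _ _ _ => rfl) fun l hl hl' => (huv l hl hl').symm,
    hext a ha b hb hau hbu, hux, fun l hl hl' => ?_⟩
  rw [hau l (by omega) hl', hux l hl hl']

theorem LocalFamily.card_le [Finite A] [Finite ι] (hS : ShiftInvariant S) (hrec : Recurrent S)
    (hiso : NoIsolated S) (h : LocalFamily S R f g) {x₀ : ℤ → A} (hx₀ : x₀ ∈ S)
    (hsep : Separates x₀ R M f) {C N₀ : ℕ} (hC : ∀ n ≥ N₀, (blocks S n).ncard ≤ C * n) :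
    Nat.card ι ≤ 4 * C := by
  obtain ⟨u, hu, v, hv, u', hu', v', hv', p, q, hp, hq, hne, hne', huv, huv', hux, hux'⟩ :=
    exists_bispecial hS hrec hiso hx₀ (N₀ + 2 * (M + 3 * R) + 1)
  obtain ⟨N, hN⟩ : ∃ N : ℕ, (N : ℤ) = q - p - 1 := ⟨(q - p - 1).toNat, by omega⟩
  have h1 := h.mul_card_le_of_left hS hx₀ hsep hu hv (k := 0) hne huv
    (fun l hl hl' => by rw [zero_add]; exact hux l (by omega) (by omega))
    (by push_cast at *; omega) (by push_cast at *; omega) hN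
  have h2 := h.mul_card_le_of_right hS hx₀ hsep hu' hv' (k := 0) hne' huv'
    (fun l hl hl' => by rw [zero_add]; exact hux' l (by omega) (by omega))
    (by push_cast at *; omega) (by push_cast at *; omega) hN
  have h3 : ((blocks S N).ncard : ℤ) ≤ C * N := by exact_mod_cast hC N (by omega)
  have h4 : (0 : ℤ) ≤ Nat.card ι := Int.natCast_nonneg _
  push_cast at *
  -- The sum of `h1` and `h2` has the factor `N - 1 - 2(M + 3R)`, which is at least `N / 2` by the
  -- choice of margin in `exists_bispecial`.
  have h5 : (N : ℤ) * Nat.card ι ≤ N * (4 * C) := by nlinarith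
  have h6 := le_of_mul_le_mul_left h5 (by omega)
  exact_mod_cast h6

end Combinatorics

end LowComplexity

namespace LowComplexity

open SymbolicDynamics.FullShift Filter Topology

open scoped ENNReal

/-! ### Automorphisms as sliding block codes. -/

section Topological

variable {A : Type*} [TopologicalSpace A] {X : Subshift A ℤ}

lemma shiftInvariant_carrier (X : Subshift A ℤ) : ShiftInvariant X.carrier :=
  fun _ hx n => X.mapsTo n hx

lemma shiftHomeo_add (m n : ℤ) : shiftHomeo X (m + n) = shiftHomeo X m * shiftHomeo X n := by
  ext x k
  simp [shiftHomeo, add_comm m n, add_assoc]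

lemma sigma_zpow (n : ℤ) : sigma X ^ n = shiftHomeo X n := by
  induction n with
  | zero =>
    ext x k
    simp [shiftHomeo]
  | succ n ih => rw [zpow_add_one, ih, shiftHomeo_add]; rfl
  | pred n ih =>
    rw [zpow_sub_one, ih, mul_inv_eq_iff_eq_mul, sigma, ← shiftHomeo_add, sub_add_cancel]

lemma sigmaAut_zpow_apply (n : ℤ) (x : X.carrier) (k : ℤ) :
    ((sigmaAut X ^ n : Aut X).1 x).1 k = x.1 (n + k) := by
  have : (sigmaAut X ^ n : Aut X).1 = shiftHomeo X n := sigma_zpow n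
  rw [this]
  rfl

lemma commute_sigmaAut (φ : Aut X) : Commute φ (sigmaAut X) :=
  Subtype.ext (Subgroup.mem_centralizer_iff.1 φ.2 (sigma X) rfl).symm

lemma apply_shiftHomeo (φ : Aut X) (n : ℤ) (x : X.carrier) :
    φ.1 (shiftHomeo X n x) = shiftHomeo X n (φ.1 x) := by
  have := congrArg Subtype.val ((commute_sigmaAut φ).zpow_right n).eq
  have h2 : (sigmaAut X ^ n : Aut X).1 = shiftHomeo X n := sigma_zpow n
  rw [Subgroup.coe_mul, Subgroup.coe_mul, h2] at this
  exact DFunLike.congr_fun this x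

/-- The iterates of a transitive point are dense in `X`. -/
lemma denseRange_shiftHomeo {x : X.carrier} (hx : closure (orbit x.1) = X.carrier) :
    DenseRange fun n : ℤ => shiftHomeo X n x := by
  rw [DenseRange, Subtype.dense_iff, ← Set.range_comp]
  exact hx.ge

lemma aut_ext_of_dense [T2Space A] {x : X.carrier} (hx : closure (orbit x.1) = X.carrier)
    {φ ψ : Aut X} (h : φ.1 x = ψ.1 x) : φ = ψ := by
  refine Subtype.ext (Homeomorph.ext (congrFun ?_))
  refine (denseRange_shiftHomeo hx).equalizer φ.1.continuous ψ.1.continuous (funext fun n => ?_)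
  simp only [Function.comp, apply_shiftHomeo, h]

/-- A continuous function to a discrete space depends on finitely many coordinates only. -/
lemma exists_window [Finite A] [DiscreteTopology A]
    {B : Type*} [TopologicalSpace B] [DiscreteTopology B] {F : X.carrier → B}
    (hF : Continuous F) :
    ∃ n : ℕ, ∀ x y : X.carrier, (∀ l : ℤ, -n ≤ l → l ≤ n → x.1 l = y.1 l) → F x = F y := by
  by_contra! hcon
  have : CompactSpace X.carrier := isCompact_iff_compactSpace.1 X.isClosed.isCompact
  have hclosed : ∀ n : ℕ, IsClosed {z : X.carrier × X.carrier |
      (∀ l : ℤ, -n ≤ l → l ≤ n → z.1.1 l = z.2.1 l) ∧ F z.1 ≠ F z.2} := by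
    intro n
    have h1 : IsClosed {z : X.carrier × X.carrier |
        ∀ l : ℤ, -n ≤ l → l ≤ n → z.1.1 l = z.2.1 l} := by
      simp only [Set.ofPred_forall]
      refine isClosed_iInter fun l => isClosed_iInter fun _ => isClosed_iInter fun _ =>
        isClosed_eq
          ((continuous_apply l).comp (continuous_subtype_val.comp continuous_fst))
          ((continuous_apply l).comp (continuous_subtype_val.comp continuous_snd))
    have h2 : IsClosed {z : X.carrier × X.carrier | F z.1 ≠ F z.2} :=
      (isClosed_discrete {b : B × B | b.1 ≠ b.2}).preimage
        (f := fun z : X.carrier × X.carrier => (F z.1, F z.2)) (by fun_prop)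
    exact h1.inter h2
  -- By compactness some pair agrees on every window and still has different values under `F`.
  obtain ⟨z, hz⟩ := IsCompact.nonempty_iInter_of_sequence_nonempty_isCompact_isClosed
    (fun n : ℕ => {z : X.carrier × X.carrier |
      (∀ l : ℤ, -n ≤ l → l ≤ n → z.1.1 l = z.2.1 l) ∧ F z.1 ≠ F z.2})
    (fun n z hz => ⟨fun l hl hl' => hz.1 l (by push_cast; omega) (by push_cast; omega), hz.2⟩)
    (fun n => by
      obtain ⟨x, y, hxy, hne⟩ := hcon n
      exact ⟨(x, y), hxy, hne⟩)
    (hclosed 0).isCompact hclosed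
  rw [Set.mem_iInter] at hz
  exact (hz 0).2 (congrArg F (Subtype.ext (funext fun l =>
    (hz l.natAbs).1 l (by omega) (by omega))))

lemma isOpen_window [DiscreteTopology A] (z : ℤ → A) (n : ℕ) :
    IsOpen {y : X.carrier | ∀ l : ℤ, -n ≤ l → l ≤ n → y.1 l = z l} := by
  convert (isOpen_cylinder (Finset.Icc (-n : ℤ) n) z).preimage
    (continuous_subtype_val : Continuous (Subtype.val : X.carrier → ℤ → A)) using 1
  ext y
  simp [mem_cylinder]

lemma noIsolated_iff [Finite A] [DiscreteTopology A] :
    NoIsolated X.carrier ↔ ∀ x : X.carrier, ¬ IsOpen {x} := by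
  classical
  constructor
  · intro h x hx
    obtain ⟨n, hn⟩ := exists_window
      ((continuous_boolIndicator_iff_isClopen ({x} : Set X.carrier)).2 ⟨isClosed_singleton, hx⟩)
    obtain ⟨y, hy, hne, hyx⟩ := h x.1 x.2 n
    have := hn ⟨y, hy⟩ x hyx
    rw [(Set.mem_iff_boolIndicator _ _).1 (Set.mem_singleton x),
      ← Set.mem_iff_boolIndicator] at this
    exact hne (congrArg Subtype.val this)
  · intro h x hx n
    by_contra! hcon
    refine h ⟨x, hx⟩ ?_
    convert isOpen_window (X := X) x n using 1
    ext y
    refine ⟨fun hy l _ _ => by rw [hy], fun hy => Subtype.ext ?_⟩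
    by_contra hne
    obtain ⟨l, hl, hl', hne'⟩ := hcon y.1 y.2 hne
    exact hne' (hy l hl hl')

lemma recurrent_of_noIsolated [Finite A] [DiscreteTopology A]
    {x : X.carrier} (hx : closure (orbit x.1) = X.carrier)
    (hiso : NoIsolated X.carrier) : Recurrent X.carrier := by
  intro z hz n K
  have : ∀ y : X.carrier, NeBot (𝓝[≠] y) := fun y =>
    ⟨fun h => noIsolated_iff.1 hiso y ((isOpen_singleton_iff_punctured_nhds y).2 h)⟩
  set U : Set X.carrier := {y | ∀ l : ℤ, -n ≤ l → l ≤ n → y.1 l = z l} with hU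
  set T : Set ℤ := {k | shiftHomeo X k x ∈ U} with hT
  -- In a space without isolated points, removing finitely many points from a dense set leaves it
  -- dense.
  have hTinf : T.Infinite := by
    intro hfin
    obtain ⟨y, hy, ⟨k, rfl⟩, hyT⟩ :=
      ((denseRange_shiftHomeo hx).sdiff_finite
        (hfin.image fun k => shiftHomeo X k x)).inter_open_nonempty U (isOpen_window z n)
        ⟨⟨z, hz⟩, fun _ _ _ => rfl⟩
    exact hyT ⟨k, hy, rfl⟩
  obtain ⟨a, ha⟩ := hTinf.nonempty
  obtain ⟨b, hb, hab⟩ := hTinf.exists_notMem_finite (Set.finite_Icc (a - K) (a + K))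
  have key : ∀ a ∈ T, ∀ b ∈ T, a + K ≤ b → ∃ y ∈ X.carrier, ∃ k : ℤ, K ≤ k ∧
      ∀ l : ℤ, -n ≤ l → l ≤ n → y l = z l ∧ y (k + l) = z l := by
    intro a ha b hb hab
    refine ⟨_, (shiftHomeo X a x).2, b - a, by omega, fun l hl hl' => ⟨ha l hl hl', ?_⟩⟩
    rw [← hb l hl hl']
    show x.1 (a + (b - a + l)) = x.1 (b + l)
    ring_nf
  rw [Set.mem_Icc, not_and_or] at hab
  rcases hab with hab | hab
  · exact key b hb a ha (by omega)
  · exact key a ha b hb (by omega)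

/-- Automorphisms are sliding block codes. -/
lemma exists_radius [Finite A] [DiscreteTopology A]
    (φ : Aut X) : ∃ R : ℕ, ∀ x y : X.carrier, ∀ k : ℤ,
    (∀ l : ℤ, k - R ≤ l → l ≤ k + R → x.1 l = y.1 l) → (φ.1 x).1 k = (φ.1 y).1 k := by
  obtain ⟨R, hR⟩ := exists_window (F := fun x : X.carrier => (φ.1 x).1 0)
    (((continuous_apply 0).comp continuous_subtype_val).comp φ.1.continuous)
  refine ⟨R, fun x y k hxy => ?_⟩
  have := hR (shiftHomeo X k x) (shiftHomeo X k y)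
    fun l hl hl' => hxy (k + l) (by omega) (by omega)
  simp only [apply_shiftHomeo] at this
  simpa [shiftHomeo] using this

open Classical in
/-- An automorphism of `X`, extended to all configurations by the identity. -/
noncomputable def autExtend (φ : Aut X) (x : ℤ → A) : ℤ → A :=
  if h : x ∈ X.carrier then (φ.1 ⟨x, h⟩).1 else x

lemma autExtend_apply (φ : Aut X) {x : ℤ → A} (hx : x ∈ X.carrier) :
    autExtend φ x = (φ.1 ⟨x, hx⟩).1 := dif_pos hx

lemma exists_localFamily [Finite A] [DiscreteTopology A] {ι : Type*} [Finite ι] (φ : ι → Aut X) :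
    ∃ R : ℕ, LocalFamily X.carrier R (fun i => autExtend (φ i)) (fun i => autExtend (φ i)⁻¹) := by
  choose r hr using fun i => exists_radius (φ i)
  choose s hs using fun i => exists_radius (φ i)⁻¹
  obtain ⟨R, hR⟩ := (Set.finite_range r).bddAbove
  obtain ⟨T, hT⟩ := (Set.finite_range s).bddAbove
  refine ⟨max R T, ?_, ?_, ?_, ?_, ?_⟩
  · intro i x hx
    rw [autExtend_apply _ hx]
    exact Subtype.property _
  · intro i x hx
    rw [autExtend_apply _ hx, autExtend_apply _ (Subtype.property _)]
    exact congrArg Subtype.val ((φ i).1.symm_apply_apply ⟨x, hx⟩)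
  · intro i x hx n k
    rw [autExtend_apply _ hx, autExtend_apply _ (shiftInvariant_carrier X x hx n)]
    exact congrFun (congrArg Subtype.val (apply_shiftHomeo (φ i) n ⟨x, hx⟩)) k
  · intro i x hx y hy k hxy
    rw [autExtend_apply _ hx, autExtend_apply _ hy]
    have : r i ≤ R := hR ⟨i, rfl⟩
    exact hr i _ _ k fun l hl hl' => hxy l (by push_cast; omega) (by push_cast; omega)
  · intro i x hx y hy k hxy
    rw [autExtend_apply _ hx, autExtend_apply _ hy]
    have : s i ≤ T := hT ⟨i, rfl⟩
    exact hs i _ _ k fun l hl hl' => hxy l (by push_cast; omega) (by push_cast; omega)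

/-- If no `p` worked for some `i`, `j`, `c`, then `φ i` and `φ j` would agree at `x` up to `σ ^ c`,
hence lie in the same coset. There are finitely many triples, so one `M` serves all. -/
lemma exists_separates [DiscreteTopology A] {ι : Type*} [Finite ι] {x : X.carrier}
    (hx : closure (orbit x.1) = X.carrier) {φ : ι → Aut X}
    (hφ : Function.Injective fun i => (φ i : Aut X ⧸ shiftSubgroup X)) (R : ℕ) :
    ∃ M : ℕ, Separates x.1 R M (fun i => autExtend (φ i)) := by
  have hne : ∀ i j (c : ℤ), ∃ p : ℤ, i ≠ j → autExtend (φ i) x.1 p ≠ autExtend (φ j) x.1 (p + c) := by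
    intro i j c
    by_contra! hcon
    refine (hcon 0).1 (hφ (QuotientGroup.eq.2 ⟨-c, ?_⟩))
    rw [eq_inv_mul_iff_mul_eq]
    refine aut_ext_of_dense hx (Subtype.ext (funext fun k => ?_))
    rw [((commute_sigmaAut (φ i)).zpow_right (-c)).eq, Subgroup.coe_mul, Homeomorph.mul_apply,
      sigmaAut_zpow_apply]
    have := (hcon (-c + k)).2
    rw [autExtend_apply _ x.2, autExtend_apply _ x.2] at this
    rw [this]
    ring_nf
  choose p hp using hne
  obtain ⟨M, hM⟩ := (Set.finite_range fun t : ι × ι × Set.Icc (-(2 * R) : ℤ) (2 * R) =>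
    (p t.1 t.2.1 t.2.2.1).natAbs).bddAbove
  refine ⟨M, fun i j hij c hc hc' => ⟨p i j c, ?_, ?_, hp i j c hij⟩⟩ <;>
  · have : (p i j c).natAbs ≤ M := hM ⟨(i, j, ⟨c, hc, hc'⟩), rfl⟩
    omega

/-! ### Finiteness of the quotient. -/

lemma exists_linear_bound (h : growthRate X < ⊤) :
    ∃ C N₀ : ℕ, ∀ n ≥ N₀, (blocks X.carrier n).ncard ≤ C * n := by
  obtain ⟨c, hc, hc'⟩ := exists_between h
  obtain ⟨C, hC⟩ := ENNReal.exists_nat_gt hc'.ne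
  obtain ⟨N, hN⟩ := eventually_atTop.1 (eventually_lt_of_limsup_lt hc)
  -- `N + 1` keeps `n` nonzero in the division.
  refine ⟨C, N + 1, fun n hn => ?_⟩
  have h1 := ((hN n (by omega)).trans hC).le
  rw [ENNReal.div_le_iff (by simp; omega) (by simp)] at h1
  exact_mod_cast h1

theorem finite_quotient_of_noIsolated [Finite A] [DiscreteTopology A]
    {x : X.carrier} (hx : closure (orbit x.1) = X.carrier)
    (hiso : NoIsolated X.carrier) (hfin : growthRate X < ⊤) :
    Finite (Aut X ⧸ shiftSubgroup X) := by
  by_contra hinf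
  rw [not_finite_iff_infinite] at hinf
  obtain ⟨C, N₀, hC⟩ := exists_linear_bound hfin
  let φ : Fin (4 * C + 1) → Aut X := fun i =>
    (Infinite.natEmbedding (Aut X ⧸ shiftSubgroup X) i).out
  have hφ : Function.Injective fun i => (φ i : Aut X ⧸ shiftSubgroup X) := by
    intro i j hij
    simp only [φ, QuotientGroup.out_eq'] at hij
    exact Fin.ext ((Infinite.natEmbedding (Aut X ⧸ shiftSubgroup X)).injective hij)
  obtain ⟨R, hR⟩ := exists_localFamily φ
  obtain ⟨M, hM⟩ := exists_separates hx hφ R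
  have := hR.card_le (shiftInvariant_carrier X) (recurrent_of_noIsolated hx hiso) hiso x.2 hM hC
  simp at this

/-- If the transitive point is isolated, then every automorphism is a power of the shift. -/
theorem finite_quotient_of_isOpen_singleton [DiscreteTopology A] {x z : X.carrier}
    (hx : closure (orbit x.1) = X.carrier) (hz : IsOpen {z}) :
    Finite (Aut X ⧸ shiftSubgroup X) := by
  have hmem : ∀ y : X.carrier, IsOpen {y} → ∃ n : ℤ, shiftHomeo X n x = y := by
    intro y hy
    obtain ⟨_, rfl, n, hn⟩ := (denseRange_shiftHomeo hx).inter_open_nonempty {y} hy ⟨y, rfl⟩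
    exact ⟨n, hn⟩
  obtain ⟨a, rfl⟩ := hmem z hz
  have hzpow : ∀ φ : Aut X, φ ∈ shiftSubgroup X := by
    intro φ
    -- The image of an isolated point is isolated, hence on the orbit of `x`.
    obtain ⟨b, hb⟩ := hmem (φ.1 (shiftHomeo X a x)) (by
      rw [← Set.image_singleton]
      exact φ.1.isOpenMap _ hz)
    rw [apply_shiftHomeo] at hb
    refine ⟨b - a, aut_ext_of_dense hx ?_⟩
    apply (shiftHomeo X a).injective
    rw [← hb]
    ext k
    show ((sigmaAut X ^ (b - a) : Aut X).1 x).1 (a + k) = x.1 (b + k)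
    rw [sigmaAut_zpow_apply]
    ring_nf
  have : Subsingleton (Aut X ⧸ shiftSubgroup X) := by
    have : shiftSubgroup X = ⊤ := eq_top_iff.2 fun φ _ => hzpow φ
    rw [this]
    exact QuotientGroup.subsingleton_quotient_top
  infer_instance

/-- Positive growth thus excludes finite `X`, on which `σ` would have finite order. -/
lemma growthRate_eq_zero_of_finite (h : X.carrier.Finite) : growthRate X = 0 := by
  have hle : ∀ n, complexity X n ≤ X.carrier.ncard := by
    intro n
    have : words X n ⊆ (fun (x : ℤ → A) (i : Fin n) => x ((i : ℕ) : ℤ)) '' X.carrier := by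
      rintro w ⟨x, hx, hw⟩
      exact ⟨x, hx, funext hw⟩
    exact (Set.ncard_le_ncard this (h.image _)).trans (Set.ncard_image_le h)
  have hlim : Tendsto (fun n : ℕ => (X.carrier.ncard : ℝ≥0∞) / (n : ℝ≥0∞)) atTop (𝓝 0) := by
    have := ENNReal.Tendsto.const_div (a := (X.carrier.ncard : ℝ≥0∞)) ENNReal.tendsto_nat_nhds_top
      (Or.inr (ENNReal.natCast_ne_top _))
    simpa using this
  refine (tendsto_of_tendsto_of_tendsto_of_le_of_le tendsto_const_nhds hlim (fun _ => zero_le)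
    fun n => ?_).limsup_eq
  exact ENNReal.div_le_div_right (by exact_mod_cast hle n) _

/-- On an infinite transitive subshift the shift has infinite order. -/
lemma injective_zpow_sigmaAut [DiscreteTopology A] (htrans : IsTransitive X) (hpos : 0 < growthRate X) :
    Function.Injective fun n : ℤ => sigmaAut X ^ n := by
  obtain ⟨x, hxX, hx⟩ := htrans
  rw [injective_zpow_iff_not_isOfFinOrder, isOfFinOrder_iff_zpow_eq_one]
  rintro ⟨n, hn, hσ⟩
  refine hpos.ne' (growthRate_eq_zero_of_finite ?_)
  have hmul : ∀ a k : ℤ, x (n * a + k) = x k := by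
    intro a k
    have := sigmaAut_zpow_apply (n * a) ⟨x, hxX⟩ k
    rw [zpow_mul, hσ, one_zpow] at this
    exact this.symm
  have horb : (orbit x).Finite := by
    refine ((Set.finite_Icc (-|n|) |n|).image fun k => shift k x).subset ?_
    rintro _ ⟨m, rfl⟩
    refine ⟨m % n, ⟨(neg_nonpos.2 (abs_nonneg n)).trans (Int.emod_nonneg m hn),
      (Int.emod_lt_abs m hn).le⟩, funext fun k => ?_⟩
    show x (m % n + k) = x (m + k)
    rw [← hmul (m / n) (m % n + k), ← add_assoc, Int.mul_ediv_add_emod]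
  rw [← hx, horb.isClosed.closure_eq]
  exact horb

end Topological

end LowComplexity

theorem theorem3 {A : Type*} [Finite A] [TopologicalSpace A] [DiscreteTopology A]
    (X : SymbolicDynamics.FullShift.Subshift A ℤ)
    (htrans : LowComplexity.IsTransitive X)
    (hpos : 0 < LowComplexity.growthRate X) (hfin : LowComplexity.growthRate X < ⊤) :
    Finite (LowComplexity.Aut X ⧸ LowComplexity.shiftSubgroup X) ∧
      LowComplexity.IsVirtually (LowComplexity.Aut X) (Multiplicative ℤ) := by
  open LowComplexity in
  have hquot : Finite (Aut X ⧸ shiftSubgroup X) := by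
    obtain ⟨x, hxX, hx⟩ := htrans
    by_cases hiso : NoIsolated X.carrier
    · exact finite_quotient_of_noIsolated (x := ⟨x, hxX⟩) hx hiso hfin
    · rw [noIsolated_iff] at hiso
      push Not at hiso
      obtain ⟨z, hz⟩ := hiso
      exact finite_quotient_of_isOpen_singleton (x := ⟨x, hxX⟩) hx hz
  refine ⟨hquot, LowComplexity.shiftSubgroup X, Subgroup.finiteIndex_of_finite_quotient, ⟨?_⟩⟩
  have hinj : Function.Injective (zpowersHom _ (LowComplexity.sigmaAut X)) :=
    LowComplexity.injective_zpow_sigmaAut htrans hpos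
  exact ((MonoidHom.ofInjective hinj).trans
    (MulEquiv.subgroupCongr (Subgroup.range_zpowersHom _))).symm
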